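/- \textbf{Model.} The typical user is at the origin, the centre of a disc of radius $\varrho\in(0,\infty)$ in the plane. Three independent homogeneous Poisson point processes on the disc describe the base stations: the F-APs that cache the requested content ($F_c$, density $p_{hit}\lambda_F$, power $P_F$), the F-APs that do not ($\tilde F_c$, density $(1-p_{hit})\lambda_F$, power $P_F$) and the RRHs ($R$, density $\lambda_R$, power $P_R$), with $\lambda_F,\lambda_R,P_F,P_R>0$. Here $p_{hit}=\sum_{i=1}^{M}i^{-\tau}/\sum_{i=1}^{N}i^{-\tau}$ with $M<N$ and $\tau\ge 0$. A station at distance $r$ is received with power $S=P|h|^2r^{-\alpha}$, where $\alpha>2$ and the gains $|h|^2$ are independent (also of the positions) and exponential with mean $1$. The noise power is $\sigma^2>0$. The SINR of an F-AP $x$ is $S_x/(\sum_{y\ne x}S_y+\sigma^2)$, the sum being over all other stations. The SINR of an RRH $x$ is $\zeta S_x/(\sum_{y\in\text{F-APs}}S_y+\upsilon\sum_{y\in\text{RRHs},\,y\ne x}S_y+\sigma^2)$, where, for $B$ feedback bits and $N_B\ge 2$ antennas, $\zeta=1-2^B\,\mathrm{Beta}\bigl(2^B,\tfrac{N_B}{N_B-1}\bigr)$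 and $\upsilon=2^{-B/(N_B-1)}$. The instantaneous rate of $x$ is $R_x=\log_2(1+\mathrm{SINR}_x)$. \textbf{Latencies.} Let $L>0$ be the content length, $\xi>0$ the request rate of a user, $N_j\ge 0$ the number of users of a station of class $j\in\{F_c,\tilde F_c,R\}$, and $\rho'_j=N_j\xi L$ its traffic. The queueing model of a station with rate $\mathcal R$ and traffic $\rho'<\mathcal R$ has transmission time $L/\mathcal R$ and waiting time $\frac{L}{\mathcal R}\frac{\rho}{1-\rho}$ with $\rho=\rho'/\mathcal R$; write $q(\rho',\mathcal R)$ for their sum. For a constant $d>0$ let $D_{back}=d\,\rho'_{back}$ and $D_{front}=d\,\rho'_{front}$, where $\rho'_{back}$ and $\rho'_{front}$ are the mean total traffics of the stations of class $\tilde F_c$ and of class $R$. Put $\ell_{F_c}=0$, $\ell_{\tilde F_c}=D_{back}$, $\ell_R=D_{front}$. A station $x$ of class $j$ offers the latency $D_x=q(\rho'_j,R_x)+\ell_j$ if $\rho'_j<R_x$, and $D_x=\infty$ otherwise. \textbf{Association.} Let $\beta_j>\ell_j$ be latency targets. Under minimal-delay association the user is served by the station of minimal latency among the stations $x$ with $D_x<\beta_j$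 ($j$ the class of $x$), if there is one. The association probabilities are $$A_j=\frac{\mathbb P(\exists\, x \text{ of class } j:\ D_x<\beta_j)}{\mathbb P(\exists\, i,\ \exists\, x \text{ of class } i:\ D_x<\beta_i)} .$$ Let $\theta_j=2^{\rho'_j+L/(\beta_j-\ell_j)}-1$, the SINR above which $D_x<\beta_j$, and assume $\theta_{F_c}>1$, $\theta_{\tilde F_c}>1$ and $\theta_R>\zeta/\upsilon$. \textbf{Average latency.} Let $\mathbb E[R_F]$ (respectively $\mathbb E[R_R]$) be the average ergodic rate of F-AP users (RRH users): the expectation of the rate $R_x$ of the station $x$ of maximal reference signal receiving power $P r^{-\alpha}$, given that this station is an F-AP (an RRH). Assume stability: $\rho'_{F_c}<\mathbb E[R_F]$, $\rho'_{\tilde F_c}<\mathbb E[R_F]$, $\rho'_R<\mathbb E[R_R]$. The mean delivery latency at class $j$ is $\bar D_j=q(\rho'_j,\mathbb E[R_j])+\ell_j$, where $\mathbb E[R_{F_c}]=\mathbb E[R_{\tilde F_c}]=\mathbb E[R_F]$. The average delivery latency of the typical user is $D=\mathbb E[\bar D_J\mid\text{the user is served}]$, where $J$ is the class of the serving station. \textbf{Lemma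 7.} Under these assumptions $$D=A_{F_c}\frac{L}{\mathbb E[R_F]-\rho'_{F_c}}+A_{\tilde F_c}\left[\frac{L}{\mathbb E[R_F]-\rho'_{\tilde F_c}}+D_{back}\right]+A_R\left[\frac{L}{\mathbb E[R_R]-\rho'_R}+D_{front}\right].$$ -/

import Mathlib

noncomputable section

namespace FRAN

open MeasureTheory ProbabilityTheory

/-- The three classes of base stations seen by the typical user: F-APs that cache the requested
content, F-APs that do not, and RRHs. -/
inductive Tier
  | cached
  | uncached
  | rrh

/-- A base station is addressed by its class and its number inside the class. -/
abbrev Station := Tier × ℕ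

/-- The plane. -/
abbrev Plane := EuclideanSpace ℝ (Fin 2)

/-- The deterministic parameters of the network. -/
structure Params where
  /-- radius of the disc in which the base stations are deployed -/
  radius : ℝ
  /-- density of F-APs -/
  lamF : ℝ
  /-- density of RRHs -/
  lamR : ℝ
  /-- transmit power of F-APs -/
  PF : ℝ
  /-- transmit power of RRHs -/
  PR : ℝ
  /-- path loss exponent -/
  alpha : ℝ
  /-- noise variance -/
  sigma2 : ℝ
  /-- number of contents in the database -/
  numContents : ℕ
  /-- number of contents stored in each cache -/
  numCached : ℕ
  /-- Zipf exponent -/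
  tau : ℝ
  /-- content length -/
  len : ℝ
  /-- number of feedback bits -/
  feedbackBits : ℕ
  /-- number of antennas of an RRH -/
  antennas : ℕ
  /-- number of users served by a base station of the class -/
  load : Tier → ℝ
  /-- service request rate of a user -/
  xi : ℝ
  /-- proportionality constant between link traffic and link latency -/
  d : ℝ
  /-- latency targets -/
  beta : Tier → ℝ
  radius_pos : 0 < radius
  lamF_pos : 0 < lamF
  lamR_pos : 0 < lamR
  PF_pos : 0 < PF
  PR_pos : 0 < PR
  two_lt_alpha : 2 < alpha
  sigma2_pos : 0 < sigma2
  numCached_lt : numCached < numContents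
  tau_nonneg : 0 ≤ tau
  len_pos : 0 < len
  two_le_antennas : 2 ≤ antennas
  load_nonneg : ∀ j, 0 ≤ load j
  xi_pos : 0 < xi
  d_pos : 0 < d

namespace Params

variable (p : Params)

/-- Zipf popularity of the `i`-th most popular content. -/
def zipf (i : ℕ) : ℝ :=
  (1 / (i : ℝ) ^ p.tau) / ∑ j ∈ Finset.Icc 1 p.numContents, 1 / (j : ℝ) ^ p.tau

/-- Caching hit probability when the most popular contents are cached. -/
def pHit : ℝ := ∑ i ∈ Finset.Icc 1 p.numCached, p.zipf i

/-- Density of each class of base stations. -/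
def density : Tier → ℝ
  | .cached => p.pHit * p.lamF
  | .uncached => (1 - p.pHit) * p.lamF
  | .rrh => p.lamR

/-- Transmit power of each class. -/
def power : Tier → ℝ
  | .cached => p.PF
  | .uncached => p.PF
  | .rrh => p.PR

/-- Coefficient of the useful signal of an RRH under limited feedback: with the codebook size
`2 ^ B` and `m` antennas, `1 - 2 ^ B * Beta (2 ^ B, m / (m - 1))`. -/
def zeta : ℝ :=
  1 - (2 : ℝ) ^ p.feedbackBits *
    ProbabilityTheory.beta ((2 : ℝ) ^ p.feedbackBits) ((p.antennas : ℝ) / ((p.antennas : ℝ) - 1))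

/-- Coefficient of the residual interference among RRHs under limited feedback. -/
def upsilon : ℝ := (2 : ℝ) ^ (-((p.feedbackBits : ℝ) / ((p.antennas : ℝ) - 1)))

/-- Traffic of a base station of the class: number of users, times request rate, times content
length. -/
def traffic (j : Tier) : ℝ := p.load j * p.xi * p.len

end Params

/-- Queueing model of a base station: a content of length `len`, sent at rate `rate` by a station
with traffic `traffic` and hence traffic intensity `traffic / rate`, needs the transmission time
`len / rate` and the waiting time `(len / rate) * intensity / (1 - intensity)`.
Meaningful for `traffic < rate`. -/
def queueLatency (len traffic rate : ℝ) : ℝ :=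
  len / rate + len / rate * ((traffic / rate) / (1 - traffic / rate))

/-- The independent sources of randomness. -/
inductive Source
  | count (i : Tier)
  | pos (i : Tier) (k : ℕ)
  | gain (i : Tier) (k : ℕ)

/-- The information carried by a source of randomness. -/
@[reducible] def sourceSigma {Ω : Type*} (count : Tier → Ω → ℕ) (pos : Tier → ℕ → Ω → Plane)
    (gain : Tier → ℕ → Ω → ℝ) : Source → MeasurableSpace Ω
  | .count i => MeasurableSpace.comap (count i) inferInstance
  | .pos i k => MeasurableSpace.comap (pos i k) inferInstance
  | .gain i k => MeasurableSpace.comap (gain i k) inferInstance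

/-- The random network around the typical user at the origin. Each class of base stations is a
homogeneous Poisson point process on the disc: a Poisson number of points, placed independently and
uniformly; the classes are independent, and each station has an independent Rayleigh fading power
gain `|h|²`, exponentially distributed with mean one. -/
structure Network (p : Params) {Ω : Type*} [MeasurableSpace Ω] (P : Measure Ω) where
  /-- number of stations of the class; the stations are those numbered below it -/
  count : Tier → Ω → ℕ
  /-- positions of the stations -/
  pos : Tier → ℕ → Ω → Plane
  /-- fading power gains between the stations and the typical user -/
  gain : Tier → ℕ → Ω → ℝ
  measurable_count : ∀ i, Measurable (count i)
  measurable_pos : ∀ i k, Measurable (pos i k)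
  measurable_gain : ∀ i k, Measurable (gain i k)
  gain_nonneg : ∀ i k ω, 0 ≤ gain i k ω
  law_count : ∀ i, P.map (count i) =
    poissonMeasure (p.density i * (Real.pi * p.radius ^ 2)).toNNReal
  law_pos : ∀ i k, P.map (pos i k) =
    ProbabilityTheory.cond (volume : Measure Plane) (Metric.ball 0 p.radius)
  law_gain : ∀ i k, P.map (gain i k) = expMeasure 1
  indep : iIndep (sourceSigma count pos gain) P

namespace Network

variable {p : Params} {Ω : Type*} [MeasurableSpace Ω] {P : Measure Ω} (net : Network p P)

/-- The station `x` is present in the realization `ω`. -/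
def Present (ω : Ω) (x : Station) : Prop := x.2 < net.count x.1 ω

/-- Reference signal receiving power of `x` (no fading) at the typical user. -/
def rsrp (ω : Ω) (x : Station) : ℝ := p.power x.1 * ‖net.pos x.1 x.2 ω‖ ^ (-p.alpha)

/-- Instantaneous power received from `x`. -/
def signal (ω : Ω) (x : Station) : ℝ :=
  p.power x.1 * net.gain x.1 x.2 ω * ‖net.pos x.1 x.2 ω‖ ^ (-p.alpha)

open Classical in
/-- Total power received from all stations of class `i` other than `x`. -/
def othersPower (ω : Ω) (x : Station) (i : Tier) : ℝ :=
  ∑ k ∈ (Finset.range (net.count i ω)).filter (fun k => (i, k) ≠ x), net.signal ω (i, k)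

/-- Signal to interference plus noise ratio at the typical user when `x` serves it. -/
def sinr (ω : Ω) (x : Station) : ℝ :=
  match x.1 with
  | .rrh => p.zeta * net.signal ω x /
      (net.othersPower ω x .cached + net.othersPower ω x .uncached
        + p.upsilon * net.othersPower ω x .rrh + p.sigma2)
  | _ => net.signal ω x /
      (net.othersPower ω x .cached + net.othersPower ω x .uncached
        + net.othersPower ω x .rrh + p.sigma2)

/-- Instantaneous Shannon rate offered by `x`. -/
def rate (ω : Ω) (x : Station) : ℝ := Real.logb 2 (1 + net.sinr ω x)

/-- `x` is the station from which the typical user has the maximal RSRP. -/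
def IsStrongest (ω : Ω) (x : Station) : Prop :=
  net.Present ω x ∧ ∀ y, net.Present ω y → net.rsrp ω y ≤ net.rsrp ω x

open Classical in
/-- Average ergodic rate of the typical user at the classes in `T`: the mean rate offered by
the station of maximal RSRP, given that this station belongs to a class in `T`. -/
def ergodicRate (T : Set Tier) : ℝ :=
  ∫ ω, (if h : ∃ x, net.IsStrongest ω x ∧ x.1 ∈ T then net.rate ω h.choose else 0)
    ∂(ProbabilityTheory.cond P {ω | ∃ x, net.IsStrongest ω x ∧ x.1 ∈ T})

/-- `E[R_F]`, both kinds of F-APs together. -/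
def ergodicRateF : ℝ := net.ergodicRate {.cached, .uncached}

/-- `E[R_R]`. -/
def ergodicRateR : ℝ := net.ergodicRate {.rrh}

/-- Mean total traffic of the stations of class `i`. -/
def totalTraffic (i : Tier) : ℝ :=
  ∫ ω, ∑ _k ∈ Finset.range (net.count i ω), p.traffic i ∂P

/-- Latency of the backhaul links. -/
def dBack : ℝ := p.d * net.totalTraffic .uncached

/-- Latency of the fronthaul links. -/
def dFront : ℝ := p.d * net.totalTraffic .rrh

/-- Latency of the wired link through which the content reaches a station of the class. -/
def linkLatency : Tier → ℝ
  | .cached => 0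
  | .uncached => net.dBack
  | .rrh => net.dFront

open Classical in
/-- Instantaneous delivery latency offered by `x`; infinite when its queue is unstable. -/
def stationLatency (ω : Ω) (x : Station) : ENNReal :=
  if p.traffic x.1 < net.rate ω x then
    ENNReal.ofReal (queueLatency p.len (p.traffic x.1) (net.rate ω x) + net.linkLatency x.1)
  else ⊤

/-- `x` is present and its latency is below the target of its class. -/
def MeetsTarget (ω : Ω) (x : Station) : Prop :=
  net.Present ω x ∧ net.stationLatency ω x < ENNReal.ofReal (p.beta x.1)

/-- Minimal delay association: `x` has the minimal latency among the stations that meet the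
latency target of their class. -/
def IsServing (ω : Ω) (x : Station) : Prop :=
  net.MeetsTarget ω x ∧
    ∀ y, net.MeetsTarget ω y → net.stationLatency ω x ≤ net.stationLatency ω y

/-- SINR that a station of class `j` has to exceed in order to meet the latency target: its rate
must exceed `traffic + len / (target - link latency)`. -/
def sinrThreshold (j : Tier) : ℝ :=
  (2 : ℝ) ^ (p.traffic j + p.len / (p.beta j - net.linkLatency j)) - 1

/-- Minimal delay association probability of class `j`: the probability that some station of
class `j` meets its latency target, divided by the probability that some station does. -/
def assocProb (j : Tier) : ℝ :=
  P.real {ω | ∃ k, net.MeetsTarget ω (j, k)} / P.real {ω | ∃ x, net.MeetsTarget ω x}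

/-- Average ergodic rate at a class. -/
def tierRate : Tier → ℝ
  | .cached => net.ergodicRateF
  | .uncached => net.ergodicRateF
  | .rrh => net.ergodicRateR

/-- Mean delivery latency of a user served by class `j`: transmission and waiting time at the
average ergodic rate, plus the latency of the wired link. -/
def tierLatency (j : Tier) : ℝ :=
  queueLatency p.len (p.traffic j) (net.tierRate j) + net.linkLatency j

open Classical in
/-- Average delivery latency of the typical user under minimal delay association: the expectation
of the mean delivery latency at the class of the serving station, given that the user is
associated with a station. -/
def averageLatency : ℝ :=
  ∫ ω, (if h : ∃ x, net.IsServing ω x then net.tierLatency h.choose.1 else 0)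
    ∂(ProbabilityTheory.cond P {ω | ∃ x, net.IsServing ω x})

end Network

end FRAN

end

open MeasureTheory ProbabilityTheory

namespace FRAN

/-! The thresholds force uniqueness: a station that meets its target is received with strictly more
power than every other present station, so two stations cannot both meet theirs
(`eq_of_meetsTarget`). Hence serving and meeting the target coincide, and the event of being served
is the disjoint union over the classes of the events in the numerators of the association
probabilities. The class latency is constant on each piece, so its conditional mean is the weighted
sum `averageLatency_eq_sum`; the queueing formula then simplifies each term. The Gamma estimates
serve only to give `0 ≤ zeta`, which the RRH case needs. -/

/-! ### Gamma and Beta estimates; the queueing formula. -/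

theorem factorial_mul_Gamma_le {b : ℝ} (hb : 1 ≤ b) (n : ℕ) :
    (n.factorial : ℝ) * Real.Gamma b ≤ Real.Gamma (n + b) := by
  induction n with
  | zero => simp
  | succ n ih =>
    have hpos : 0 < (n : ℝ) + b := by positivity
    have hG : 0 < Real.Gamma (n + b) := Real.Gamma_pos_of_pos hpos
    have hrec : Real.Gamma (((n + 1 : ℕ) : ℝ) + b) = (n + b) * Real.Gamma (n + b) := by
      rw [← Real.Gamma_add_one hpos.ne']
      push_cast
      ring_nf
    rw [hrec, Nat.factorial_succ]
    push_cast
    calc ((n : ℝ) + 1) * n.factorial * Real.Gamma b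
        = (n + 1) * (n.factorial * Real.Gamma b) := by ring
      _ ≤ (n + 1) * Real.Gamma (n + b) := by gcongr
      _ ≤ (n + b) * Real.Gamma (n + b) := by gcongr

/-- Since `n * Γ(n) = n!`, the left side is `n! * Γ(b) / Γ(n + b)`. With `n = 2 ^ B` this gives the
sign of `zeta`. -/
theorem natCast_mul_beta_le_one {n : ℕ} (hn : 0 < n) {b : ℝ} (hb : 1 ≤ b) :
    (n : ℝ) * ProbabilityTheory.beta n b ≤ 1 := by
  have hn' : (n : ℝ) ≠ 0 := by positivity
  have hG : 0 < Real.Gamma (n + b) := Real.Gamma_pos_of_pos (by positivity)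
  rw [ProbabilityTheory.beta, ← mul_div_assoc, div_le_one hG, ← mul_assoc,
    ← Real.Gamma_add_one hn', Real.Gamma_nat_eq_factorial]
  exact factorial_mul_Gamma_le hb n

/-- With intensity `ρ`, this is `1 + ρ / (1 - ρ) = 1 / (1 - ρ)`. -/
theorem queueLatency_eq {len traffic rate : ℝ} (h0 : 0 ≤ traffic) (h : traffic < rate) :
    queueLatency len traffic rate = len / (rate - traffic) := by
  have h1 : rate ≠ 0 := by linarith
  have h2 : rate - traffic ≠ 0 := by linarith
  have h3 : 1 - traffic / rate ≠ 0 := by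
    rw [one_sub_div h1]
    exact div_ne_zero h2 h1
  unfold queueLatency
  field_simp
  ring

namespace Params

variable (p : Params)

theorem zeta_nonneg : 0 ≤ p.zeta := by
  have hm : (2 : ℝ) ≤ p.antennas := by exact_mod_cast p.two_le_antennas
  have hb : 1 ≤ (p.antennas : ℝ) / ((p.antennas : ℝ) - 1) := by
    rw [le_div_iff₀ (by linarith)]
    linarith
  have h := natCast_mul_beta_le_one (n := 2 ^ p.feedbackBits) (by positivity) hb
  push_cast at h
  exact sub_nonneg.2 h

theorem upsilon_pos : 0 < p.upsilon := Real.rpow_pos_of_pos two_pos _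

theorem upsilon_le_one : p.upsilon ≤ 1 := by
  have hm : (2 : ℝ) ≤ p.antennas := by exact_mod_cast p.two_le_antennas
  refine Real.rpow_le_one_of_one_le_of_nonpos one_le_two (neg_nonpos.2 ?_)
  exact div_nonneg (Nat.cast_nonneg _) (by linarith)

theorem traffic_nonneg (j : Tier) : 0 ≤ p.traffic j :=
  mul_nonneg (mul_nonneg (p.load_nonneg j) p.xi_pos.le) p.len_pos.le

theorem power_pos (j : Tier) : 0 < p.power j := by
  cases j
  exacts [p.PF_pos, p.PF_pos, p.PR_pos]

end Params

/-! ### Domination in received power and uniqueness of the serving station. -/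

namespace Network

variable {p : Params} {Ω : Type*} [MeasurableSpace Ω] {P : Measure Ω} (net : Network p P)

theorem signal_nonneg (ω : Ω) (x : Station) : 0 ≤ net.signal ω x :=
  mul_nonneg (mul_nonneg (p.power_pos _).le (net.gain_nonneg _ _ _))
    (Real.rpow_nonneg (norm_nonneg _) _)

theorem othersPower_nonneg (ω : Ω) (x : Station) (i : Tier) : 0 ≤ net.othersPower ω x i :=
  Finset.sum_nonneg fun _ _ => net.signal_nonneg _ _

theorem signal_le_othersPower {ω : Ω} {x y : Station} (hy : net.Present ω y) (hxy : y ≠ x) :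
    net.signal ω y ≤ net.othersPower ω x y.1 := by
  classical
  unfold othersPower
  refine Finset.single_le_sum (f := fun k => net.signal ω (y.1, k))
    (fun _ _ => net.signal_nonneg _ _) (a := y.2) ?_
  simp only [Finset.mem_filter, Finset.mem_range]
  exact ⟨hy, hxy⟩

theorem sinr_nonneg (ω : Ω) (x : Station) : 0 ≤ net.sinr ω x := by
  have hs := net.signal_nonneg ω x
  have ho := net.othersPower_nonneg ω x
  have hσ := p.sigma2_pos
  have hυ := mul_nonneg p.upsilon_pos.le (ho .rrh)
  have hζ := mul_nonneg p.zeta_nonneg hs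
  have h1 := ho .cached
  have h2 := ho .uncached
  have h3 := ho .rrh
  obtain ⟨j, k⟩ := x
  cases j <;> simp only [sinr] <;> exact div_nonneg (by assumption) (by linarith)

variable {net}

/-- In the form `len / (rate - traffic)` the latency bound can be solved for the rate, and the
logarithm then inverted because `1 + sinr` is positive. -/
theorem MeetsTarget.sinrThreshold_lt {ω : Ω} {x : Station} (h : net.MeetsTarget ω x)
    (hβ : net.linkLatency x.1 < p.beta x.1) : net.sinrThreshold x.1 < net.sinr ω x := by
  obtain ⟨-, h⟩ := h
  unfold stationLatency at h
  split_ifs at h with hr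
  · have h' := (ENNReal.ofReal_lt_ofReal_iff'.1 h).1
    rw [queueLatency_eq (p.traffic_nonneg _) hr, ← lt_sub_iff_add_lt,
      div_lt_iff₀ (sub_pos.2 hr), ← div_lt_iff₀' (sub_pos.2 hβ)] at h'
    have h1 : 0 < 1 + net.sinr ω x := by linarith [net.sinr_nonneg ω x]
    have h2 : p.traffic x.1 + p.len / (p.beta x.1 - net.linkLatency x.1)
        < Real.logb 2 (1 + net.sinr ω x) := by
      change _ < net.rate ω x
      linarith
    rw [Real.lt_logb_iff_rpow_lt one_lt_two h1] at h2
    unfold sinrThreshold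
    linarith
  · exact absurd h not_top_lt

variable (net)

theorem sinrThreshold_pos {j : Tier} (hβ : net.linkLatency j < p.beta j) :
    0 < net.sinrThreshold j := by
  refine sub_pos.2 (Real.one_lt_rpow one_lt_two ?_)
  exact add_pos_of_nonneg_of_pos (p.traffic_nonneg j) (div_pos p.len_pos (sub_pos.2 hβ))

/-- An F-AP whose SINR exceeds one is received with more power than any other station. -/
theorem signal_lt_of_one_lt_sinr {ω : Ω} {x y : Station} (hx : x.1 ≠ .rrh)
    (hsinr : 1 < net.sinr ω x) (hy : net.Present ω y) (hxy : y ≠ x) :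
    net.signal ω y < net.signal ω x := by
  have ho := net.othersPower_nonneg ω x
  have hσ := p.sigma2_pos
  have h1 := ho .cached
  have h2 := ho .uncached
  have h3 := ho .rrh
  have hD : 0 < net.othersPower ω x .cached + net.othersPower ω x .uncached
      + net.othersPower ω x .rrh + p.sigma2 := by linarith
  have hle := net.signal_le_othersPower hy hxy
  -- The signal of `x` beats the whole interference plus noise, of which the signal of `y` is one
  -- summand.
  have key : net.othersPower ω x .cached + net.othersPower ω x .uncached
      + net.othersPower ω x .rrh + p.sigma2 < net.signal ω x := by
    obtain ⟨j, k⟩ := x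
    cases j
    · exact (one_lt_div hD).1 hsinr
    · exact (one_lt_div hD).1 hsinr
    · exact absurd rfl hx
  obtain ⟨i, l⟩ := y
  cases i <;> simp only at hle <;> linarith

/-- An RRH whose SINR exceeds `zeta / upsilon` is received with more power than any other
station. -/
theorem signal_lt_of_lt_sinr_rrh {ω : Ω} {x y : Station} (hx : x.1 = .rrh)
    (hsinr : p.zeta / p.upsilon < net.sinr ω x) (hpos : 0 < net.sinr ω x)
    (hy : net.Present ω y) (hxy : y ≠ x) :
    net.signal ω y < net.signal ω x := by
  have ho := net.othersPower_nonneg ω x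
  have hσ := p.sigma2_pos
  have h1 := ho .cached
  have h2 := ho .uncached
  have h3 := ho .rrh
  have hυ := p.upsilon_pos
  have hυ1 := p.upsilon_le_one
  have hυ3 := mul_nonneg hυ.le h3
  have hle := net.signal_le_othersPower hy hxy
  obtain ⟨j, k⟩ := x
  obtain rfl : j = .rrh := hx
  set D := net.othersPower ω (.rrh, k) .cached + net.othersPower ω (.rrh, k) .uncached
      + p.upsilon * net.othersPower ω (.rrh, k) .rrh + p.sigma2 with hDdef
  have hD : 0 < D := by linarith
  have hs : net.sinr ω (.rrh, k) = p.zeta * net.signal ω (.rrh, k) / D := rfl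
  rw [hs] at hsinr hpos
  -- If `zeta` vanished, so would the SINR; strict positivity is needed to cancel `zeta` below.
  have hζ : 0 < p.zeta := by
    rcases p.zeta_nonneg.lt_or_eq with h | h
    · exact h
    · simp [← h] at hpos
  -- F-APs enter `D` with weight one and RRHs with weight `upsilon ≤ 1`, so `y` always has weight at
  -- least `upsilon`; the noise makes the inequality strict.
  have hyD : p.upsilon * net.signal ω y < D := by
    have hsy := net.signal_nonneg ω y
    have hyle : p.upsilon * net.signal ω y ≤ net.signal ω y :=
      mul_le_of_le_one_left hsy hυ1
    obtain ⟨i, l⟩ := y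
    cases i <;> simp only at hle
    · linarith
    · linarith
    · linarith [mul_le_mul_of_nonneg_left hle hυ.le]
  rw [div_lt_div_iff₀ hυ hD, mul_assoc, mul_lt_mul_iff_right₀ hζ] at hsinr
  rw [mul_comm] at hyD
  exact lt_of_mul_lt_mul_right (hyD.trans hsinr) hυ.le

theorem signal_lt_of_meetsTarget
    (hβ : ∀ j, net.linkLatency j < p.beta j)
    (hθc : 1 < net.sinrThreshold .cached) (hθu : 1 < net.sinrThreshold .uncached)
    (hθR : p.zeta / p.upsilon < net.sinrThreshold .rrh)
    {ω : Ω} {x y : Station} (hx : net.MeetsTarget ω x)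
    (hy : net.Present ω y) (hxy : y ≠ x) : net.signal ω y < net.signal ω x := by
  have h := hx.sinrThreshold_lt (hβ _)
  have h0 := (net.sinrThreshold_pos (hβ x.1)).trans h
  obtain ⟨j, k⟩ := x
  cases j
  · exact net.signal_lt_of_one_lt_sinr (by simp) (hθc.trans h) hy hxy
  · exact net.signal_lt_of_one_lt_sinr (by simp) (hθu.trans h) hy hxy
  · exact net.signal_lt_of_lt_sinr_rrh rfl (hθR.trans h) h0 hy hxy

/-- At most one station meets its latency target. -/
theorem eq_of_meetsTarget
    (hβ : ∀ j, net.linkLatency j < p.beta j)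
    (hθc : 1 < net.sinrThreshold .cached) (hθu : 1 < net.sinrThreshold .uncached)
    (hθR : p.zeta / p.upsilon < net.sinrThreshold .rrh)
    {ω : Ω} {x y : Station} (hx : net.MeetsTarget ω x)
    (hy : net.MeetsTarget ω y) : x = y := by
  by_contra hne
  exact lt_asymm
    (net.signal_lt_of_meetsTarget hβ hθc hθu hθR hx hy.1 (Ne.symm hne))
    (net.signal_lt_of_meetsTarget hβ hθc hθu hθR hy hx.1 hne)

/-- Minimality is automatic: by uniqueness the only competitor is the station itself. -/
theorem isServing_iff_meetsTarget
    (hβ : ∀ j, net.linkLatency j < p.beta j)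
    (hθc : 1 < net.sinrThreshold .cached) (hθu : 1 < net.sinrThreshold .uncached)
    (hθR : p.zeta / p.upsilon < net.sinrThreshold .rrh)
    {ω : Ω} {x : Station} :
    net.IsServing ω x ↔ net.MeetsTarget ω x := by
  refine ⟨fun h => h.1, fun h => ⟨h, fun y hy => ?_⟩⟩
  rw [net.eq_of_meetsTarget hβ hθc hθu hθR h hy]

/-! ### Measurability of the association events. -/

theorem measurable_signal (x : Station) : Measurable fun ω => net.signal ω x := by
  unfold signal
  exact ((net.measurable_gain _ _).const_mul _).mul ((net.measurable_pos _ _).norm.pow_const _)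

theorem measurable_othersPower (x : Station) (i : Tier) :
    Measurable fun ω => net.othersPower ω x i := by
  classical
  -- The range of summation is random, so the count is first made a separate variable in a countable
  -- space.
  have h : Measurable fun q : ℕ × Ω =>
      ∑ k ∈ (Finset.range q.1).filter (fun k => (i, k) ≠ x), net.signal q.2 (i, k) :=
    measurable_from_prod_countable_right fun n =>
      Finset.measurable_sum ((Finset.range n).filter fun k => (i, k) ≠ x)
        fun k _ => net.measurable_signal (i, k)
  convert h.comp ((net.measurable_count i).prodMk measurable_id) using 1
  funext ω
  unfold othersPower
  simp only [Function.comp, id]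

theorem measurable_sinr (x : Station) : Measurable fun ω => net.sinr ω x := by
  have hs := net.measurable_signal x
  have ho := net.measurable_othersPower x
  obtain ⟨j, k⟩ := x
  cases j <;> simp only [sinr]
  · exact hs.div ((((ho _).add (ho _)).add (ho _)).add_const _)
  · exact hs.div ((((ho _).add (ho _)).add (ho _)).add_const _)
  · exact (hs.const_mul _).div ((((ho _).add (ho _)).add ((ho _).const_mul _)).add_const _)

theorem measurable_rate (x : Station) : Measurable fun ω => net.rate ω x :=
  (Real.measurable_log.comp ((net.measurable_sinr x).const_add 1)).div_const _

theorem measurable_stationLatency (x : Station) :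
    Measurable fun ω => net.stationLatency ω x := by
  have hr := net.measurable_rate x
  unfold stationLatency queueLatency
  refine Measurable.ite (measurableSet_lt measurable_const hr) ?_ measurable_const
  fun_prop

theorem measurableSet_meetsTarget (x : Station) : MeasurableSet {ω | net.MeetsTarget ω x} :=
  (measurableSet_lt measurable_const (net.measurable_count x.1)).inter
    (measurableSet_lt (net.measurable_stationLatency x) measurable_const)

theorem measurableSet_exists_meetsTarget (j : Tier) :
    MeasurableSet {ω | ∃ k, net.MeetsTarget ω (j, k)} := by
  rw [Set.ofPred_exists]
  exact MeasurableSet.iUnion fun k => net.measurableSet_meetsTarget (j, k)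

/-! ### Averaging over the class of the serving station. -/

theorem setOf_exists_meetsTarget :
    {ω | ∃ x, net.MeetsTarget ω x} = {ω | ∃ k, net.MeetsTarget ω (.cached, k)} ∪
      {ω | ∃ k, net.MeetsTarget ω (.uncached, k)} ∪ {ω | ∃ k, net.MeetsTarget ω (.rrh, k)} := by
  ext ω
  constructor
  · rintro ⟨⟨j, k⟩, h⟩
    cases j
    exacts [.inl (.inl ⟨k, h⟩), .inl (.inr ⟨k, h⟩), .inr ⟨k, h⟩]
  · rintro ((⟨k, h⟩ | ⟨k, h⟩) | ⟨k, h⟩) <;> exact ⟨_, h⟩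

/-- Holds even when the conditioning event is null, since both sides are then zero by convention. -/
theorem cond_real_exists_meetsTarget (j : Tier) :
    (ProbabilityTheory.cond P {ω | ∃ x, net.MeetsTarget ω x}).real
      {ω | ∃ k, net.MeetsTarget ω (j, k)} = net.assocProb j := by
  have hm : MeasurableSet {ω | ∃ x, net.MeetsTarget ω x} := by
    rw [setOf_exists_meetsTarget]
    exact ((net.measurableSet_exists_meetsTarget _).union
      (net.measurableSet_exists_meetsTarget _)).union (net.measurableSet_exists_meetsTarget _)
  have hsub : {ω | ∃ k, net.MeetsTarget ω (j, k)} ⊆ {ω | ∃ x, net.MeetsTarget ω x} :=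
    fun ω ⟨k, h⟩ => ⟨_, h⟩
  rw [measureReal_def, ProbabilityTheory.cond_apply hm, Set.inter_eq_self_of_subset_right hsub,
    ENNReal.toReal_mul, ENNReal.toReal_inv, assocProb, div_eq_inv_mul, measureReal_def,
    measureReal_def]

open Classical in
theorem tierLatency_choose_eq_sum_indicator (hβ : ∀ j, net.linkLatency j < p.beta j)
    (hθc : 1 < net.sinrThreshold .cached) (hθu : 1 < net.sinrThreshold .uncached)
    (hθR : p.zeta / p.upsilon < net.sinrThreshold .rrh) (ω : Ω) :
    (if h : ∃ x, net.IsServing ω x then net.tierLatency h.choose.1 else 0) =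
      {ω | ∃ k, net.MeetsTarget ω (.cached, k)}.indicator
          (fun _ => net.tierLatency .cached) ω
        + {ω | ∃ k, net.MeetsTarget ω (.uncached, k)}.indicator
          (fun _ => net.tierLatency .uncached) ω
        + {ω | ∃ k, net.MeetsTarget ω (.rrh, k)}.indicator
          (fun _ => net.tierLatency .rrh) ω := by
  by_cases h : ∃ x, net.IsServing ω x
  · rw [dif_pos h]
    -- Naming the chosen station allows a case split on its class; by uniqueness that class is the
    -- only one whose indicator is nonzero.
    obtain ⟨⟨j, k⟩, hx⟩ : ∃ x, x = h.choose := ⟨_, rfl⟩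
    have hjk : net.MeetsTarget ω (j, k) := hx ▸ h.choose_spec.1
    have hmem (i : Tier) : ω ∈ {ω | ∃ k, net.MeetsTarget ω (i, k)} ↔ i = j := by
      refine ⟨fun ⟨l, hl⟩ => ?_, fun hi => ⟨k, hi ▸ hjk⟩⟩
      exact congrArg Prod.fst (net.eq_of_meetsTarget hβ hθc hθu hθR hl hjk)
    rw [← hx]
    simp only [Set.indicator_apply, hmem]
    cases j <;> simp
  · rw [dif_neg h]
    have hmem (i : Tier) : ω ∉ {ω | ∃ k, net.MeetsTarget ω (i, k)} := fun ⟨k, hk⟩ =>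
      h ⟨_, (net.isServing_iff_meetsTarget hβ hθc hθu hθR).2 hk⟩
    simp [Set.indicator_of_notMem (hmem _)]

/-- The average delivery latency is the average of the mean latencies of the classes, weighted
with the association probabilities. -/
theorem averageLatency_eq_sum [IsProbabilityMeasure P]
    (hβ : ∀ j, net.linkLatency j < p.beta j)
    (hθc : 1 < net.sinrThreshold .cached) (hθu : 1 < net.sinrThreshold .uncached)
    (hθR : p.zeta / p.upsilon < net.sinrThreshold .rrh) :
    net.averageLatency = net.assocProb .cached * net.tierLatency .cached
      + net.assocProb .uncached * net.tierLatency .uncached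
      + net.assocProb .rrh * net.tierLatency .rrh := by
  have hS : {ω | ∃ x, net.IsServing ω x} = {ω | ∃ x, net.MeetsTarget ω x} := by
    simp only [net.isServing_iff_meetsTarget hβ hθc hθu hθR]
  have hint (j : Tier) : Integrable
      ({ω | ∃ k, net.MeetsTarget ω (j, k)}.indicator fun _ => net.tierLatency j)
      (ProbabilityTheory.cond P {ω | ∃ x, net.MeetsTarget ω x}) :=
    (integrable_const _).indicator (net.measurableSet_exists_meetsTarget j)
  unfold averageLatency
  simp only [net.tierLatency_choose_eq_sum_indicator hβ hθc hθu hθR]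
  rw [hS]
  refine (integral_add ((hint .cached).add (hint .uncached)) (hint .rrh)).trans ?_
  rw [integral_add' (hint .cached) (hint .uncached)]
  simp only [integral_indicator_const _ (net.measurableSet_exists_meetsTarget _),
    net.cond_real_exists_meetsTarget, smul_eq_mul]

end Network

end FRAN

theorem lemma7 {Ω : Type*} [MeasurableSpace Ω] (P : MeasureTheory.Measure Ω)
    [MeasureTheory.IsProbabilityMeasure P] (p : FRAN.Params) (net : FRAN.Network p P)
    (hβ : ∀ j, net.linkLatency j < p.beta j)
    (hθc : 1 < net.sinrThreshold .cached)
    (hθu : 1 < net.sinrThreshold .uncached)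
    (hθR : p.zeta / p.upsilon < net.sinrThreshold .rrh)
    (hρc : p.traffic .cached < net.ergodicRateF)
    (hρu : p.traffic .uncached < net.ergodicRateF)
    (hρR : p.traffic .rrh < net.ergodicRateR) :
    net.averageLatency =
      net.assocProb .cached * (p.len / (net.ergodicRateF - p.traffic .cached))
      + net.assocProb .uncached *
          (p.len / (net.ergodicRateF - p.traffic .uncached) + net.dBack)
      + net.assocProb .rrh *
          (p.len / (net.ergodicRateR - p.traffic .rrh) + net.dFront) := by
  -- Stability enters only after this step, to evaluate the queueing latency at the ergodic rates.
  rw [net.averageLatency_eq_sum hβ hθc hθu hθR]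
  simp only [FRAN.Network.tierLatency, FRAN.Network.tierRate, FRAN.Network.linkLatency,
    FRAN.queueLatency_eq (p.traffic_nonneg _) hρc, FRAN.queueLatency_eq (p.traffic_nonneg _) hρu,
    FRAN.queueLatency_eq (p.traffic_nonneg _) hρR, add_zero]
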